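/- Let RDL+UUP (quantified difference logic over the reals with unary uninterpreted predicates) be the following logic. There are countably many variables $x_0, x_1, \dots$ and countably many unary predicate symbols $P_0, P_1, \dots$. Formulas are built from the atoms - $x \bowtie y$ (order constraints), - $x - y \bowtie c$ (difference constraints), - $P(x)$ (predicate atoms), where $x, y$ are variables, $c \in \mathbb{Z}$ is a constant, $\bowtie\ \in \{<, \leq, =, \geq, >\}$ and $P$ is a predicate symbol, by means of the connectives $\lnot, \land, \lor, \Rightarrow, \Leftrightarrow$ and the quantifiers $\forall x$ and $\exists x$. Free variables are allowed. An interpretation assigns a real number to each variable and an arbitrary subset of $\mathbb{R}$ to each predicate symbol; quantifiers range over $\mathbb{R}$, the arithmetic symbols have their usual meaning on $\mathbb{R}$, and $P(x)$ holds if and only if the value of $x$ belongs to the set assigned to $P$. A formula is satisfiable if some interpretation makes it true. **Corollary.** Satisfiability is undecidable for RDL+UUP: there is no algorithm that decides, given an arbitrary formula of RDL+UUP, whether it is satisfiable. -/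

import Mathlib

namespace RDLUUP

/-- The five comparison symbols `<`, `≤`, `=`, `≥`, `>`. -/
inductive Rel where
  | lt
  | le
  | eq
  | ge
  | gt

/-- The interpretation of a comparison symbol on the real numbers. -/
def Rel.Holds : Rel → ℝ → ℝ → Prop
  | .lt, a, b => a < b
  | .le, a, b => a ≤ b
  | .eq, a, b => a = b
  | .ge, a, b => a ≥ b
  | .gt, a, b => a > b

/-- Formulas of quantified real difference logic with unary uninterpreted predicates.  There are
countably many variables and countably many predicate symbols, both indexed by the natural
numbers.  The atoms are
* `order r x y`: the order constraint `x ⋈ y`;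
* `diff r x y c`: the difference constraint `x - y ⋈ c`, for an integer constant `c`;
* `pred P x`: the predicate atom `P(x)`. -/
inductive Formula where
  | order (r : Rel) (x y : ℕ)
  | diff (r : Rel) (x y : ℕ) (c : ℤ)
  | pred (P x : ℕ)
  | neg (φ : Formula)
  | and (φ ψ : Formula)
  | or (φ ψ : Formula)
  | imp (φ ψ : Formula)
  | iff (φ ψ : Formula)
  | all (x : ℕ) (φ : Formula)
  | ex (x : ℕ) (φ : Formula)

/-- An interpretation with domain `ℝ`: a real number for each variable and an arbitrary set of
real numbers for each predicate symbol. -/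
structure Interpretation where
  var : ℕ → ℝ
  pred : ℕ → Set ℝ

/-- `I.update x a` agrees with `I` except that the variable `x` has the value `a`. -/
def Interpretation.update (I : Interpretation) (x : ℕ) (a : ℝ) : Interpretation where
  var := Function.update I.var x a
  pred := I.pred

/-- `I.Models φ`: the interpretation `I` assigns true to `φ`. -/
def Interpretation.Models (I : Interpretation) : Formula → Prop
  | .order r x y => r.Holds (I.var x) (I.var y)
  | .diff r x y c => r.Holds (I.var x - I.var y) (c : ℝ)
  | .pred P x => I.var x ∈ I.pred P
  | .neg φ => ¬ I.Models φ
  | .and φ ψ => I.Models φ ∧ I.Models ψ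
  | .or φ ψ => I.Models φ ∨ I.Models ψ
  | .imp φ ψ => I.Models φ → I.Models ψ
  | .iff φ ψ => I.Models φ ↔ I.Models ψ
  | .all x φ => ∀ a : ℝ, (I.update x a).Models φ
  | .ex x φ => ∃ a : ℝ, (I.update x a).Models φ

/-- A formula is satisfiable if it has a model with domain `ℝ`. -/
def Formula.Satisfiable (φ : Formula) : Prop :=
  ∃ I : Interpretation, I.Models φ

/-! ### Gödel numbering

Formulas are numbered by a bijection with the natural numbers: the remainder modulo `18` is the
tag of the outermost constructor, and the quotient codes its arguments. -/

/-- The number in `{0, …, 4}` of a comparison symbol. -/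
def Rel.toNat : Rel → ℕ
  | .lt => 0
  | .le => 1
  | .eq => 2
  | .ge => 3
  | .gt => 4

/-- The Gödel number of a formula. -/
def Formula.toNat : Formula → ℕ
  | .order r x y => 18 * Nat.pair x y + r.toNat
  | .diff r x y c => 18 * Nat.pair x (Nat.pair y (Equiv.intEquivNat c)) + (5 + r.toNat)
  | .pred P x => 18 * Nat.pair P x + 10
  | .neg φ => 18 * φ.toNat + 11
  | .and φ ψ => 18 * Nat.pair φ.toNat ψ.toNat + 12
  | .or φ ψ => 18 * Nat.pair φ.toNat ψ.toNat + 13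
  | .imp φ ψ => 18 * Nat.pair φ.toNat ψ.toNat + 14
  | .iff φ ψ => 18 * Nat.pair φ.toNat ψ.toNat + 15
  | .all x φ => 18 * Nat.pair x φ.toNat + 16
  | .ex x φ => 18 * Nat.pair x φ.toNat + 17

/-- The comparison symbol with a given number. -/
def Rel.ofNat : ℕ → Rel
  | 0 => .lt
  | 1 => .le
  | 2 => .eq
  | 3 => .ge
  | _ => .gt

/-- The formula with Gödel number `n`. -/
def Formula.ofNat (n : ℕ) : Formula :=
  if n % 18 < 5 then .order (.ofNat (n % 18)) (n / 18).unpair.1 (n / 18).unpair.2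
  else if n % 18 < 10 then
    .diff (.ofNat (n % 18 - 5)) (n / 18).unpair.1 (n / 18).unpair.2.unpair.1
      (Equiv.intEquivNat.symm (n / 18).unpair.2.unpair.2)
  else if n % 18 = 10 then .pred (n / 18).unpair.1 (n / 18).unpair.2
  else if n = 0 then .pred 0 0
  else if n % 18 = 11 then .neg (.ofNat (n / 18))
  else if n % 18 = 12 then .and (.ofNat (n / 18).unpair.1) (.ofNat (n / 18).unpair.2)
  else if n % 18 = 13 then .or (.ofNat (n / 18).unpair.1) (.ofNat (n / 18).unpair.2)
  else if n % 18 = 14 then .imp (.ofNat (n / 18).unpair.1) (.ofNat (n / 18).unpair.2)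
  else if n % 18 = 15 then .iff (.ofNat (n / 18).unpair.1) (.ofNat (n / 18).unpair.2)
  else if n % 18 = 16 then .all (n / 18).unpair.1 (.ofNat (n / 18).unpair.2)
  else .ex (n / 18).unpair.1 (.ofNat (n / 18).unpair.2)
termination_by n
decreasing_by
  all_goals
    have h1 := Nat.unpair_left_le (n / 18)
    have h2 := Nat.unpair_right_le (n / 18)
    omega

theorem Rel.toNat_lt (r : Rel) : r.toNat < 5 := by
  cases r <;> simp [Rel.toNat]

theorem Rel.ofNat_toNat (r : Rel) : Rel.ofNat r.toNat = r := by
  cases r <;> rfl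

theorem Rel.toNat_ofNat (n : ℕ) (h : n < 5) : (Rel.ofNat n).toNat = n := by
  interval_cases n <;> rfl

theorem Formula.ofNat_toNat (φ : Formula) : Formula.ofNat φ.toNat = φ := by
  induction φ with
  | order r x y =>
    have h := r.toNat_lt
    have h1 : (18 * Nat.pair x y + r.toNat) % 18 = r.toNat := by omega
    have h2 : (18 * Nat.pair x y + r.toNat) / 18 = Nat.pair x y := by omega
    rw [Formula.toNat, Formula.ofNat, h1, h2, if_pos h]
    simp [Rel.ofNat_toNat]
  | diff r x y c =>
    have h := r.toNat_lt
    have h1 (m : ℕ) : (18 * m + (5 + r.toNat)) % 18 = 5 + r.toNat := by omega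
    have h2 (m : ℕ) : (18 * m + (5 + r.toNat)) / 18 = m := by omega
    rw [Formula.toNat, Formula.ofNat, h1, h2, if_neg (by omega), if_pos (by omega)]
    simp [Rel.ofNat_toNat]
  | pred P x =>
    rw [Formula.toNat, Formula.ofNat]
    simp [Nat.mul_add_div]
  | neg φ ih | all x φ ih | ex x φ ih =>
    rw [Formula.toNat, Formula.ofNat]
    simp [Nat.mul_add_div, ih]
  | and φ ψ ih ih' | or φ ψ ih ih' | imp φ ψ ih ih' | iff φ ψ ih ih' =>
    rw [Formula.toNat, Formula.ofNat]
    simp [Nat.mul_add_div, ih, ih']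

theorem Formula.toNat_ofNat (n : ℕ) : (Formula.ofNat n).toNat = n := by
  induction n using Nat.strong_induction_on with
  | _ n ih =>
    have h1 := Nat.unpair_left_le (n / 18)
    have h2 := Nat.unpair_right_le (n / 18)
    rw [Formula.ofNat]
    split_ifs <;> simp only [Formula.toNat]
    · rw [Rel.toNat_ofNat _ (by omega), Nat.pair_unpair]
      omega
    · rw [Rel.toNat_ofNat _ (by omega), Equiv.apply_symm_apply, Nat.pair_unpair, Nat.pair_unpair]
      omega
    · rw [Nat.pair_unpair]
      omega
    · omega
    · rw [ih _ (by omega)]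
      omega
    all_goals
      first
      | rw [ih _ (by omega), ih _ (by omega), Nat.pair_unpair]
        omega
      | rw [ih _ (by omega), Nat.pair_unpair]
        omega

/-- The Gödel numbering as a bijection.  It determines what it means for a function or a predicate
on formulas to be computable. -/
def Formula.equivNat : Formula ≃ ℕ where
  toFun := Formula.toNat
  invFun := Formula.ofNat
  left_inv := Formula.ofNat_toNat
  right_inv := Formula.toNat_ofNat

instance : Denumerable Formula := Denumerable.mk' Formula.equivNat

end RDLUUP

namespace RDLUUP

/-! ### Infinite runs and a universal machine -/

open Turing

/-! Halting is reduced to unsatisfiability. One Turing machine is fixed that, on input `n`, halts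
exactly when the `n`-th partial recursive code halts on `0`. A run is laid out on the real line: the
configuration at time `t` occupies the points `z + d t + i` with `i` an integer and `d` increasing
in `[0, 1)`. Translation by 1 moves along the tape, and the order inside a unit interval is time. A
difference constraint with constant 1 therefore reaches the neighbouring tape cell, and "next point
of predicate `0`", definable from the order, reaches the same position one step later. Positions are
relative to the head, so a move shifts the whole tape; state and scanned symbol are broadcast along
it by periodic predicates.

The formula demands that time never ends and makes a halting transition contradictory. In a model,
induction along the computation finds each reached configuration on the line (`Describes.step`), so
the machine cannot halt. The rules only force memberships that must hold, so neither uniqueness of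
symbols nor discreteness of time has to be axiomatised. Conversely, an infinite run gives a model
with `d t = 1 - 1 / (t + 1)` (`runInterpretation_models_dynamics`). Only the conjunct for the input
word depends on `n`, and it is primitive recursive in `n`. -/

/-- If the evaluation of a step function does not terminate, then there is an infinite run. -/
theorem exists_run_of_not_eval_dom {σ : Type*} (f : σ → Option σ) (a : σ)
    (h : ¬ (StateTransition.eval f a).Dom) :
    ∃ c : ℕ → σ, c 0 = a ∧ ∀ t, f (c t) = some (c (t + 1)) := by
  -- The run is built among the configurations reachable from `a`: a reachable one without successor
  -- would be a value of the evaluation.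
  have step (b : {b // StateTransition.Reaches f a b}) :
      ∃ b' : {b // StateTransition.Reaches f a b}, f b.1 = some b'.1 := by
    obtain ⟨b, hb⟩ := b
    cases hf : f b with
    | none => exact absurd (Part.dom_iff_mem.2 ⟨b, StateTransition.mem_eval.2 ⟨hb, hf⟩⟩) h
    | some b' => exact ⟨⟨b', hb.tail hf⟩, rfl⟩
  choose g hg using step
  have ha : StateTransition.Reaches f a a := Relation.ReflTransGen.refl
  refine ⟨fun t => (g^[t] ⟨a, ha⟩).1, rfl, fun t => ?_⟩
  simpa only [Function.iterate_succ_apply'] using hg _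

/-- A fixed Turing machine with undecidable halting behaviour, on inputs written in binary. -/
theorem exists_universal_machine :
    ∃ (Γ Λ : Type) (_ : Inhabited Γ) (_ : Finite Γ) (_ : Inhabited Λ) (M : TM0.Machine Γ Λ)
      (S : Finset Λ) (b : Γ) (w : PartrecToTM2.Γ' → Γ), TM0.Supports M (S : Set Λ) ∧
      ∀ n : ℕ, (TM0.eval M (b :: (PartrecToTM2.trNat n).reverse.map w)).Dom ↔
        ((Denumerable.ofNat Nat.Partrec.Code n).eval 0).Dom := by
  have hpart : Partrec fun n : ℕ => (Denumerable.ofNat Nat.Partrec.Code n).eval 0 :=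
    Nat.Partrec.Code.eval_part.comp (Computable.ofNat _) (Computable.const 0)
  obtain ⟨c, hc⟩ := ToPartrec.Code.exists_code (Nat.Partrec'.part_iff₁.2 hpart)
  -- Machines start in the default label, so the default is chosen to be the entry point of the
  -- program `c`.
  let _ : Inhabited PartrecToTM2.Λ' :=
    ⟨PartrecToTM2.trNormal c PartrecToTM2.Cont'.halt⟩
  have h2 := PartrecToTM2.tr_supports c PartrecToTM2.Cont'.halt
  have h1 := TM2to1.tr_supports _ h2
  have h0 := TM1to0.tr_supports _ h1
  have : Finite PartrecToTM2.K' :=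
    Finite.of_surjective
      ![PartrecToTM2.K'.main, PartrecToTM2.K'.rev, PartrecToTM2.K'.aux, PartrecToTM2.K'.stack]
      fun k => by cases k; exacts [⟨0, rfl⟩, ⟨1, rfl⟩, ⟨2, rfl⟩, ⟨3, rfl⟩]
  have hfin : Finite (TM2to1.Γ' PartrecToTM2.K' fun _ => PartrecToTM2.Γ') :=
    inferInstanceAs (Finite (Bool × (PartrecToTM2.K' → Option PartrecToTM2.Γ')))
  refine ⟨TM2to1.Γ' PartrecToTM2.K' fun _ => PartrecToTM2.Γ', _, TM2to1.Γ'.inhabited, hfin,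
    _, _, _,
    -- The main stack is written from its bottom: the first tape cell carries the bottom mark `true`
    -- and the terminator `cons`, followed by the digits in reverse.
    (true, Function.update (fun _ => none) PartrecToTM2.K'.main (some PartrecToTM2.Γ'.cons)),
    fun a => (false, Function.update (fun _ => none) PartrecToTM2.K'.main (some a)), h0,
    fun n => ?_⟩
  · have key := TM2to1.tr_eval_dom PartrecToTM2.tr PartrecToTM2.K'.main
      (PartrecToTM2.trList [n])
    have hinit : TM2.init PartrecToTM2.K'.main (PartrecToTM2.trList [n]) =
        PartrecToTM2.init c [n] := by
      simp only [TM2.init, PartrecToTM2.init]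
      congr 1
      funext k
      cases k <;> rfl
    have h3 : (TM2.eval PartrecToTM2.tr PartrecToTM2.K'.main (PartrecToTM2.trList [n])).Dom ↔
        ((Denumerable.ofNat Nat.Partrec.Code n).eval 0).Dom := by
      have := hc ⟨[n], rfl⟩
      change (StateTransition.eval (TM2.step PartrecToTM2.tr) (TM2.init _ _)).Dom ↔ _
      rw [hinit, PartrecToTM2.tr_eval, this]
      rfl
    rw [← h3, ← key, TM1to0.tr_eval]
    simp only [TM2to1.trInit, PartrecToTM2.trList, List.reverse_append, List.reverse_cons,
      List.reverse_nil, List.nil_append, List.singleton_append]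
    rfl

namespace Formula

/-- A finite conjunction. -/
def conj (l : List Formula) : Formula :=
  l.foldr Formula.and (.order .eq 0 0)

end Formula

theorem Interpretation.models_conj (I : Interpretation) (l : List Formula) :
    I.Models (.conj l) ↔ ∀ φ ∈ l, I.Models φ := by
  induction l with
  | nil => simp [Formula.conj, Interpretation.Models, Rel.Holds]
  | cons a l ih =>
    rw [List.forall_mem_cons, ← ih]
    rfl

/-! ### The formula describing the runs of a Turing machine

The predicate `0` holds at the cells, which are the points `z + d t + i`, where `z` is the value of
the variable `0`, the increasing sequence `d` lies in `[0, 1)`, the natural number `t` is the time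
and the integer `i` is the position on the tape relative to the head.  The predicates `1` and `2`
hold at the blank cells to the left and to the right of the input. -/

/-- The predicate for the cells of the configurations in state number `k`. -/
def statePred (k : ℕ) : ℕ := 3 * k + 3

/-- The predicate for the cells that hold the symbol number `k`. -/
def symPred (k : ℕ) : ℕ := 3 * k + 4

/-- The predicate for the cells of the configurations whose head reads the symbol number `k`. -/
def headPred (k : ℕ) : ℕ := 3 * k + 5

/-- The variable `x` lies in the unit interval of the head. -/
def headCell (x : ℕ) : Formula := .and (.order .le 0 x) (.diff .lt x 0 1)

/-- The variable `2` is the cell that follows the cell `1` in time. -/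
def nextCell : Formula :=
  .and (.pred 0 1) (.and (.pred 0 2) (.and (.order .lt 1 2)
    (.all 3 (.imp (.and (.order .lt 1 3) (.order .lt 3 2)) (.neg (.pred 0 3))))))

/-- The predicate `P` is invariant under unit translations. -/
def periodic (P : ℕ) : Formula :=
  .all 1 (.all 2 (.imp (.diff .eq 2 1 1) (.iff (.pred P 1) (.pred P 2))))

/-- The predicate `P` is contained in `Q`. -/
def subPred (P Q : ℕ) : Formula := .all 1 (.imp (.pred P 1) (.pred Q 1))

/-- The cells are a periodic set that contains the variable `0`, and time does not end. -/
def timeline : Formula :=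
  .and (.pred 0 0) (.and (periodic 0)
    (.all 1 (.imp (.and (.pred 0 1) (headCell 1)) (.ex 2 (.and (headCell 2) nextCell)))))

variable {Γ Λ : Type}

/-- The effect of a transition on the configuration at time `1`, which is followed by `2`. -/
noncomputable def transition (eΛ : Λ → ℕ) (eΓ : Γ → ℕ) (G : List Γ) :
    Option (Λ × TM0.Stmt Γ) → Formula
  | none => .order .lt 0 0
  | some (q, .move .left) => .and (.pred (statePred (eΛ q)) 2) (.conj (G.map fun b =>
      .all 3 (.imp (.diff .eq 1 3 1)
        (.imp (.pred (symPred (eΓ b)) 3) (.pred (symPred (eΓ b)) 2)))))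
  | some (q, .move .right) => .and (.pred (statePred (eΛ q)) 2) (.conj (G.map fun b =>
      .all 3 (.imp (.diff .eq 3 1 1)
        (.imp (.pred (symPred (eΓ b)) 3) (.pred (symPred (eΓ b)) 2)))))
  | some (q, .write a) => .and (.pred (statePred (eΛ q)) 2)
      (.and (.imp (headCell 1) (.pred (symPred (eΓ a)) 2))
        (.imp (.neg (headCell 1)) (.conj (G.map fun b =>
          .imp (.pred (symPred (eΓ b)) 1) (.pred (symPred (eΓ b)) 2)))))

/-- The transition for state `q` and head symbol `a` is carried out wherever it applies. -/
noncomputable def rule [Inhabited Λ] (M : TM0.Machine Γ Λ) (eΛ : Λ → ℕ) (eΓ : Γ → ℕ) (G : List Γ)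
    (q : Λ) (a : Γ) : Formula :=
  .all 1 (.all 2 (.imp (.and nextCell (.and (.pred (statePred (eΛ q)) 1)
    (.pred (headPred (eΓ a)) 1))) (transition eΛ eΓ G (M q a))))

/-- The blank parts of the initial tape. -/
def blanks (s : ℕ) : Formula :=
  .and (.and (.all 1 (.imp (.diff .eq 0 1 1) (.pred 1 1)))
      (.all 1 (.all 2 (.imp (.diff .eq 1 2 1) (.imp (.pred 1 1) (.pred 1 2))))))
    (.and (.all 1 (.all 2 (.imp (.diff .eq 2 1 1) (.imp (.pred 2 1) (.pred 2 2)))))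
      (.and (subPred 1 s) (subPred 2 s)))

/-- The part of the description of the runs that does not depend on the input. -/
noncomputable def dynamics [Inhabited Γ] [Inhabited Λ] (M : TM0.Machine Γ Λ) (eΛ : Λ → ℕ) (eΓ : Γ → ℕ) (G : List Γ)
    (S : List Λ) : Formula :=
  .and (.and timeline (.and (.pred (statePred (eΛ default)) 0) (blanks (symPred (eΓ default)))))
    (.and (.and (.conj (S.map fun q => periodic (statePred (eΛ q))))
        (.conj (G.map fun a => .and (periodic (headPred (eΓ a)))
          (.all 1 (.imp (headCell 1) (.imp (.pred (symPred (eΓ a)) 1)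
            (.pred (headPred (eΓ a)) 1)))))))
      (.conj (S.map fun q => .conj (G.map fun a => rule M eΛ eΓ G q a))))

/-- The variable `x₀ + i` lies in the predicate `P`. -/
def atPos (i P : ℕ) : Formula := .all 1 (.imp (.diff .eq 1 0 i) (.pred P 1))

/-- The initial tape holds the word whose symbols have the predicates in `l`. -/
def inputWord (l : List ℕ) : Formula :=
  .and (atPos l.length 2) (.conj ((List.range l.length).map fun i => atPos i (l.getD i 0)))

/-! ### Meaning of the formulas over the reals -/

section Semantics

variable (I : Interpretation)

/-- Semantic form of `headCell`. -/
def InHead (z x : ℝ) : Prop := z ≤ x ∧ x - z < 1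

/-- Semantic form of `nextCell`. -/
def Next (D : Set ℝ) (x y : ℝ) : Prop :=
  x ∈ D ∧ y ∈ D ∧ x < y ∧ ∀ w, x < w → w < y → w ∉ D

theorem models_periodic (P : ℕ) :
    I.Models (periodic P) ↔ ∀ x, x ∈ I.pred P ↔ x + 1 ∈ I.pred P := by
  simp [periodic, Interpretation.Models, Interpretation.update, Rel.Holds, sub_eq_iff_eq_add']

theorem models_timeline :
    I.Models timeline ↔ I.var 0 ∈ I.pred 0 ∧ (∀ x, x ∈ I.pred 0 ↔ x + 1 ∈ I.pred 0) ∧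
      ∀ x ∈ I.pred 0, InHead (I.var 0) x → ∃ y, InHead (I.var 0) y ∧ Next (I.pred 0) x y := by
  simp [timeline, nextCell, headCell, ← models_periodic, InHead, Next, Interpretation.Models,
    Interpretation.update, Rel.Holds]

theorem models_blanks (s : ℕ) :
    I.Models (blanks s) ↔ (I.var 0 - 1 ∈ I.pred 1 ∧ ∀ x ∈ I.pred 1, x - 1 ∈ I.pred 1) ∧
      (∀ x ∈ I.pred 2, x + 1 ∈ I.pred 2) ∧ I.pred 1 ⊆ I.pred s ∧ I.pred 2 ⊆ I.pred s := by
  have h (x y : ℝ) : x - y = 1 ↔ y = x - 1 := by grind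
  simp only [blanks, subPred, Interpretation.Models, Interpretation.update, Rel.Holds,
    Set.subset_def, Int.cast_one, Function.update_self, ne_eq, OfNat.one_ne_ofNat,
    zero_ne_one, not_false_eq_true, Function.update_of_ne, h, forall_eq]
  have h'' : (∀ x y : ℝ, x = y - 1 → x ∈ I.pred 2 → y ∈ I.pred 2) ↔
      ∀ x ∈ I.pred 2, x + 1 ∈ I.pred 2 :=
    ⟨fun H x hx => H x _ (by ring) hx, fun H x y hxy hx => by
      simpa [hxy] using H x hx⟩
  rw [h'']

/-- Semantic form of `transition`. -/
def Effect (eΛ : Λ → ℕ) (eΓ : Γ → ℕ) (x y : ℝ) : Option (Λ × TM0.Stmt Γ) → Prop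
  | none => False
  | some (q, .move .left) => y ∈ I.pred (statePred (eΛ q)) ∧
      ∀ b, x - 1 ∈ I.pred (symPred (eΓ b)) → y ∈ I.pred (symPred (eΓ b))
  | some (q, .move .right) => y ∈ I.pred (statePred (eΛ q)) ∧
      ∀ b, x + 1 ∈ I.pred (symPred (eΓ b)) → y ∈ I.pred (symPred (eΓ b))
  | some (q, .write a) => y ∈ I.pred (statePred (eΛ q)) ∧
      (InHead (I.var 0) x → y ∈ I.pred (symPred (eΓ a))) ∧
      (¬ InHead (I.var 0) x → ∀ b, x ∈ I.pred (symPred (eΓ b)) → y ∈ I.pred (symPred (eΓ b)))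

theorem models_transition (eΛ : Λ → ℕ) (eΓ : Γ → ℕ) {G : List Γ} (hG : ∀ a, a ∈ G)
    (o : Option (Λ × TM0.Stmt Γ)) :
    I.Models (transition eΛ eΓ G o) ↔ Effect I eΛ eΓ (I.var 1) (I.var 2) o := by
  have h (x y : ℝ) : x - y = 1 ↔ y = x - 1 := by grind
  have h' (x y : ℝ) : y - x = 1 ↔ y = x + 1 := by grind
  rcases o with _ | ⟨q, (_ | _) | a⟩
  · simp [transition, Effect, Interpretation.Models, Rel.Holds]
  · simp [transition, Effect, Interpretation.Models, Interpretation.models_conj,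
      Interpretation.update, Rel.Holds, hG, h]
  · simp [transition, Effect, Interpretation.Models, Interpretation.models_conj,
      Interpretation.update, Rel.Holds, hG, h']
  · simp [transition, Effect, Interpretation.Models, Interpretation.models_conj,
      Rel.Holds, hG, headCell, InHead]

theorem models_rule [Inhabited Λ] (M : TM0.Machine Γ Λ) (eΛ : Λ → ℕ) (eΓ : Γ → ℕ) {G : List Γ}
    (hG : ∀ a, a ∈ G) (q : Λ) (a : Γ) :
    I.Models (rule M eΛ eΓ G q a) ↔ ∀ x y, Next (I.pred 0) x y →
      x ∈ I.pred (statePred (eΛ q)) → x ∈ I.pred (headPred (eΓ a)) →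
      Effect I eΛ eΓ x y (M q a) := by
  simp only [rule, Interpretation.Models, models_transition _ _ _ hG]
  refine forall₂_congr fun x y => ?_
  -- Apart from its explicit points, `Effect` reads only variable `0` and the predicates, which the
  -- updates leave alone.
  have : Effect ((I.update 1 x).update 2 y) eΛ eΓ (((I.update 1 x).update 2 y).var 1)
      (((I.update 1 x).update 2 y).var 2) (M q a) ↔ Effect I eΛ eΓ x y (M q a) := by
    rcases M q a with _ | ⟨q, (_ | _) | a⟩ <;> simp [Effect, Interpretation.update]
  rw [this]
  simp [nextCell, Next, Interpretation.Models, Interpretation.update, Rel.Holds]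

theorem models_dynamics [Inhabited Γ] [Inhabited Λ] (M : TM0.Machine Γ Λ) (eΛ : Λ → ℕ) (eΓ : Γ → ℕ) {G : List Γ}
    (hG : ∀ a, a ∈ G) (S : List Λ) :
    I.Models (dynamics M eΛ eΓ G S) ↔
      (I.Models timeline ∧ I.var 0 ∈ I.pred (statePred (eΛ default)) ∧
        I.Models (blanks (symPred (eΓ default)))) ∧
      ((∀ q ∈ S, I.Models (periodic (statePred (eΛ q)))) ∧
        ∀ a, I.Models (periodic (headPred (eΓ a))) ∧
          ∀ x, InHead (I.var 0) x → x ∈ I.pred (symPred (eΓ a)) → x ∈ I.pred (headPred (eΓ a))) ∧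
      ∀ q ∈ S, ∀ a, I.Models (rule M eΛ eΓ G q a) := by
  simp [dynamics, Interpretation.Models, Interpretation.models_conj, Interpretation.update,
    Rel.Holds, hG, headCell, InHead]

theorem models_atPos (i P : ℕ) : I.Models (atPos i P) ↔ I.var 0 + i ∈ I.pred P := by
  simp [atPos, Interpretation.Models, Interpretation.update, Rel.Holds, sub_eq_iff_eq_add']

theorem models_inputWord (l : List ℕ) :
    I.Models (inputWord l) ↔ I.var 0 + l.length ∈ I.pred 2 ∧
      ∀ i (h : i < l.length), I.var 0 + i ∈ I.pred l[i] := by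
  simp only [inputWord, Interpretation.Models, Interpretation.models_conj, models_atPos,
    List.forall_mem_map, List.mem_range]
  refine and_congr_right fun _ => forall₂_congr fun i h => ?_
  rw [List.getD_eq_getElem _ _ h]

/-- A periodic set is invariant under integer translations. -/
theorem mem_add_intCast_iff {D : Set ℝ} (hD : ∀ x, x ∈ D ↔ x + 1 ∈ D) (x : ℝ) (i : ℤ) :
    x + i ∈ D ↔ x ∈ D := by
  induction i with
  | zero => simp
  | succ i ih =>
    rw [← ih, hD (x + (i : ℤ))]
    push_cast
    rw [add_assoc]
  | pred i ih =>
    rw [← ih, hD (x + (-(i : ℤ) - 1 : ℤ))]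
    push_cast
    ring_nf

/-- A point of `D` between the translates would translate back to one between `x` and `y`. Hence one
successor step at the head advances time along the whole tape. -/
theorem Next.add_intCast {D : Set ℝ} (hD : ∀ x, x ∈ D ↔ x + 1 ∈ D) {x y : ℝ} (h : Next D x y)
    (i : ℤ) : Next D (x + i) (y + i) := by
  obtain ⟨hx, hy, hxy, hw⟩ := h
  refine ⟨(mem_add_intCast_iff hD x i).2 hx, (mem_add_intCast_iff hD y i).2 hy, by linarith,
    fun w h1 h2 h => hw (w + (-i : ℤ)) ?_ ?_ ((mem_add_intCast_iff hD w _).2 h)⟩ <;>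
  · push_cast
    linarith

/-- A half-open unit interval contains just one point of each class modulo `ℤ`; this is how
`headCell` singles out position `0`. -/
theorem InHead.add_intCast_iff {z x : ℝ} (h : InHead z x) (i : ℤ) : InHead z (x + i) ↔ i = 0 := by
  obtain ⟨h1, h2⟩ := h
  refine ⟨fun ⟨h3, h4⟩ => ?_, ?_⟩
  · have h5 : (-1 : ℝ) < i := by linarith
    have h6 : (i : ℝ) < 1 := by linarith
    norm_cast at h5 h6
    omega
  · rintro rfl
    simpa using ⟨h1, h2⟩

end Semantics

/-! ### Soundness: a model excludes halting -/

theorem nth_mk₁_natCast [Inhabited Γ] (l : List Γ) (n : ℕ) :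
    (Tape.mk₁ l).nth n = l.getI n := by
  rw [Tape.mk₁, Tape.mk₂, Tape.mk'_nth_nat, ListBlank.nth_mk]

theorem nth_mk₁_of_neg [Inhabited Γ] (l : List Γ) {i : ℤ} (hi : i < 0) :
    (Tape.mk₁ l).nth i = default := by
  obtain ⟨n, rfl⟩ := Int.eq_negSucc_of_lt_zero hi
  change (ListBlank.mk []).nth n = default
  rw [ListBlank.nth_mk]
  simp

section Soundness

variable [Inhabited Γ] [Inhabited Λ] {I : Interpretation} {M : TM0.Machine Γ Λ} {eΛ : Λ → ℕ}
  {eΓ : Γ → ℕ} {G : List Γ} {S : List Λ}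

/-- The interpretation describes the configuration `c` at the cell `x` of the head. -/
structure Describes (I : Interpretation) (eΛ : Λ → ℕ) (eΓ : Γ → ℕ) (S : List Λ) (x : ℝ)
    (c : TM0.Cfg Γ Λ) : Prop where
  cell : x ∈ I.pred 0
  head : InHead (I.var 0) x
  mem : c.q ∈ S
  state : x ∈ I.pred (statePred (eΛ c.q))
  tape : ∀ i : ℤ, x + i ∈ I.pred (symPred (eΓ (c.Tape.nth i)))

/-- The blanks follow by induction outwards from both ends of the word. Predicates `1` and `2` serve
this purpose because the blank symbol's own predicate cannot be closed under translation: that would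
also spread blanks found elsewhere. -/
theorem describes_init (hG : ∀ a, a ∈ G) (hS : TM0.Supports M {q | q ∈ S})
    (hI : I.Models (dynamics M eΛ eΓ G S)) {w : List Γ}
    (hw : I.Models (inputWord (w.map fun a => symPred (eΓ a)))) :
    Describes I eΛ eΓ S (I.var 0) (TM0.init w) := by
  rw [models_dynamics _ _ _ _ hG, models_timeline, models_blanks] at hI
  obtain ⟨⟨⟨hz, -, -⟩, hq, ⟨hl, hl'⟩, hr, hls, hrs⟩, -, -⟩ := hI
  rw [models_inputWord] at hw
  obtain ⟨hr0, hw⟩ := hw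
  rw [List.length_map] at hr0
  refine ⟨hz, ⟨le_rfl, by simp⟩, hS.1, hq, fun i => ?_⟩
  change _ ∈ I.pred (symPred (eΓ ((Tape.mk₁ w).nth i)))
  have left (n : ℕ) : I.var 0 - 1 - n ∈ I.pred 1 := by
    induction n with
    | zero => simpa using hl
    | succ n ih =>
      have := hl' _ ih
      push_cast
      rwa [← sub_sub]
  have right (n : ℕ) : I.var 0 + w.length + n ∈ I.pred 2 := by
    induction n with
    | zero => simpa using hr0
    | succ n ih =>
      have := hr _ ih
      push_cast
      rwa [← add_assoc]
  rcases lt_or_ge i 0 with hi | hi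
  · rw [nth_mk₁_of_neg _ hi]
    obtain ⟨n, rfl⟩ := Int.eq_negSucc_of_lt_zero hi
    convert hls (left n) using 1
    push_cast
    ring
  · lift i to ℕ using hi
    rw [nth_mk₁_natCast]
    rcases lt_or_ge i w.length with hi | hi
    · have := hw i (by simpa using hi)
      rw [List.getElem_map] at this
      rwa [List.getI_eq_getElem _ hi]
    · rw [List.getI_eq_default _ hi]
      convert hrs (right (i - w.length)) using 1
      push_cast [hi]
      ring

/-- The successor `y` of `x` in the head interval translates to successors `y + i` of `x + i`. By
periodicity the same rule fires at every `x + i`, and its effect there gives the new symbol at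
position `i`. -/
theorem Describes.step (hG : ∀ a, a ∈ G) (hS : TM0.Supports M {q | q ∈ S})
    (hI : I.Models (dynamics M eΛ eΓ G S)) {x : ℝ} {c : TM0.Cfg Γ Λ}
    (h : Describes I eΛ eΓ S x c) :
    ∃ c' y, TM0.step M c = some c' ∧ Describes I eΛ eΓ S y c' := by
  simp only [models_dynamics _ _ _ _ hG, models_timeline, models_blanks, models_periodic,
    models_rule _ _ _ _ hG] at hI
  obtain ⟨⟨⟨-, hD, hnext⟩, -, -⟩, ⟨hQ, hH⟩, hrule⟩ := hI
  obtain ⟨y, hy, hxy⟩ := hnext x h.cell h.head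
  obtain ⟨q, T⟩ := c
  have hq := h.mem
  have hhead : x ∈ I.pred (headPred (eΓ T.head)) :=
    (hH _).2 x h.head (by simpa using h.tape 0)
  have effect (i : ℤ) : Effect I eΛ eΓ (x + i) (y + i) (M q T.head) :=
    hrule q hq _ _ _ (hxy.add_intCast hD i) ((mem_add_intCast_iff (hQ _ hq) x i).2 h.state)
      ((mem_add_intCast_iff (hH _).1 x i).2 hhead)
  have supp (p) (hp : M q T.head = some p) : p.1 ∈ S := hS.2 hp hq
  rcases hM : M q T.head with _ | ⟨q', (_ | _) | a⟩ <;> simp only [hM, Effect] at effect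
  · exact (effect 0).elim
  all_goals
    refine ⟨_, y, by rw [TM0.step, hM]; rfl, hxy.2.1, hy, supp _ hM,
      by simpa using (effect 0).1, fun i => ?_⟩
    dsimp only
  · rw [Tape.move_left_nth]
    refine (effect i).2 _ ?_
    simpa [add_sub_assoc] using h.tape (i - 1)
  · rw [Tape.move_right_nth]
    refine (effect i).2 _ ?_
    simpa [add_assoc] using h.tape (i + 1)
  · rw [Tape.write_nth]
    have := effect i
    rw [h.head.add_intCast_iff] at this
    split_ifs with hi
    · exact this.2.1 hi
    · exact this.2.2 hi _ (h.tape i)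

theorem not_dom_of_models (hG : ∀ a, a ∈ G) (hS : TM0.Supports M {q | q ∈ S})
    (hI : I.Models (dynamics M eΛ eΓ G S)) {w : List Γ}
    (hw : I.Models (inputWord (w.map fun a => symPred (eΓ a)))) :
    ¬ (TM0.eval M w).Dom := by
  intro h
  obtain ⟨b, hb⟩ := Part.dom_iff_mem.1
    (show (StateTransition.eval (TM0.step M) (TM0.init w)).Dom from h)
  obtain ⟨hreach, hnone⟩ := StateTransition.mem_eval.1 hb
  have : ∃ x, Describes I eΛ eΓ S x b := by
    clear hb hnone h
    induction hreach with
    | refl => exact ⟨_, describes_init hG hS hI hw⟩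
    | tail _ h ih =>
      obtain ⟨x, hx⟩ := ih
      obtain ⟨c', y, hc', hy⟩ := hx.step hG hS hI
      obtain rfl := Option.some.inj (hc'.symm.trans h)
      exact ⟨y, hy⟩
  obtain ⟨x, hx⟩ := this
  obtain ⟨c', y, hc', -⟩ := hx.step hG hS hI
  rw [hnone] at hc'
  cases hc'

end Soundness

/-! ### The model given by an infinite run -/

/-- The cell at time `t` and position `i`. -/
noncomputable def cell (t : ℕ) (i : ℤ) : ℝ := i + (1 - 1 / ((t : ℝ) + 1))

/-- The cells whose time and position satisfy `p`. -/
def cells (p : ℕ → ℤ → Prop) : Set ℝ := {x | ∃ t i, p t i ∧ cell t i = x}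

theorem offset_nonneg (t : ℕ) : 0 ≤ 1 - 1 / ((t : ℝ) + 1) := by
  have : 1 / ((t : ℝ) + 1) ≤ 1 := by
    rw [div_le_one (by positivity)]
    simp
  linarith

theorem offset_lt_one (t : ℕ) : 1 - 1 / ((t : ℝ) + 1) < 1 := by
  have : 0 < 1 / ((t : ℝ) + 1) := by positivity
  linarith

/-- The offsets stay in `[0, 1)`, so the position decides first; they increase with `t`, so time
breaks ties. -/
theorem cell_lt_cell {s t : ℕ} {i j : ℤ} : cell s i < cell t j ↔ i < j ∨ i = j ∧ s < t := by
  have key : i < j → cell s i < cell t j := fun h => by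
    have : (i : ℝ) + 1 ≤ j := by exact_mod_cast h
    have := offset_nonneg t
    have := offset_lt_one s
    unfold cell
    linarith
  have key' : j < i → cell t j < cell s i := fun h => by
    have : (j : ℝ) + 1 ≤ i := by exact_mod_cast h
    have := offset_nonneg s
    have := offset_lt_one t
    unfold cell
    linarith
  rcases lt_trichotomy i j with h | rfl | h
  · simp [h, key h]
  · have hs : (0 : ℝ) < s + 1 := by positivity
    have ht : (0 : ℝ) < t + 1 := by positivity
    simp [cell, inv_lt_inv₀ ht hs]
  · simp [h.not_gt, h.ne', (key' h).le]

theorem cell_inj {s t : ℕ} {i j : ℤ} : cell s i = cell t j ↔ s = t ∧ i = j := by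
  refine ⟨fun h => ?_, by rintro ⟨rfl, rfl⟩; rfl⟩
  have h1 := mt cell_lt_cell.2 h.not_lt
  have h2 := mt cell_lt_cell.2 h.not_gt
  omega

@[simp]
theorem cell_mem_cells {p : ℕ → ℤ → Prop} {t : ℕ} {i : ℤ} : cell t i ∈ cells p ↔ p t i := by
  simp [cells, cell_inj]

theorem cell_add_one (t : ℕ) (i : ℤ) : cell t i + 1 = cell t (i + 1) := by
  simp only [cell]
  push_cast
  ring

theorem cell_sub_one (t : ℕ) (i : ℤ) : cell t i - 1 = cell t (i - 1) := by
  simp only [cell]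
  push_cast
  ring

theorem cell_zero_left (i : ℤ) : cell 0 i = i := by simp [cell]

theorem inHead_zero_cell {t : ℕ} {i : ℤ} : InHead 0 (cell t i) ↔ i = 0 := by
  have h : InHead 0 (1 - 1 / ((t : ℝ) + 1)) := ⟨offset_nonneg t, by simpa using offset_lt_one t⟩
  rw [cell, add_comm, h.add_intCast_iff]

theorem cells_add_one {p : ℕ → ℤ → Prop} (hp : ∀ t i, p t i ↔ p t (i + 1)) (x : ℝ) :
    x ∈ cells p ↔ x + 1 ∈ cells p := by
  constructor
  · rintro ⟨t, i, h, rfl⟩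
    rw [cell_add_one, cell_mem_cells]
    exact (hp _ _).1 h
  · rintro ⟨t, i, h, hx⟩
    obtain rfl : cell t (i - 1) = x := by rw [← cell_sub_one, hx, add_sub_cancel_right]
    rw [cell_mem_cells]
    exact (hp _ _).2 (by simpa using h)

theorem next_cell {t : ℕ} {i : ℤ} {y : ℝ} :
    Next (cells fun _ _ => True) (cell t i) y ↔ y = cell (t + 1) i := by
  constructor
  · rintro ⟨-, ⟨s, j, -, rfl⟩, hlt, h⟩
    have h1 : ¬ cell (t + 1) i < cell s j := fun h' =>
      h _ (cell_lt_cell.2 (by omega)) h' (cell_mem_cells.2 trivial)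
    rw [cell_lt_cell] at h1 hlt
    rw [cell_inj]
    omega
  · rintro rfl
    refine ⟨cell_mem_cells.2 trivial, cell_mem_cells.2 trivial, cell_lt_cell.2 (by omega), ?_⟩
    rintro _ h1 h2 ⟨s, j, -, rfl⟩
    rw [cell_lt_cell] at h1 h2
    omega

variable [Inhabited Γ]

/-- The interpretation that describes the run `c` on an input of length `n`. -/
noncomputable def runInterpretation (c : ℕ → TM0.Cfg Γ Λ) (n : ℕ) (eΛ : Λ → ℕ) (eΓ : Γ → ℕ) :
    Interpretation where
  var _ := 0
  pred
    | 0 => cells fun _ _ => True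
    | 1 => cells fun t i => t = 0 ∧ i < 0
    | 2 => cells fun t i => t = 0 ∧ n ≤ i
    | k + 3 => cells fun t i =>
      if k % 3 = 0 then eΛ (c t).q = k / 3
      else if k % 3 = 1 then eΓ ((c t).Tape.nth i) = k / 3
      else eΓ (c t).Tape.head = k / 3

section

variable (c : ℕ → TM0.Cfg Γ Λ) (n : ℕ) (eΛ : Λ → ℕ) (eΓ : Γ → ℕ) (k : ℕ)

theorem runInterpretation_statePred :
    (runInterpretation c n eΛ eΓ).pred (statePred k) = cells fun t _ => eΛ (c t).q = k := by
  simp [runInterpretation, statePred]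

theorem runInterpretation_symPred :
    (runInterpretation c n eΛ eΓ).pred (symPred k) =
      cells fun t i => eΓ ((c t).Tape.nth i) = k := by
  have h1 : (3 * k + 1) % 3 = 1 := by omega
  have h2 : (3 * k + 1) / 3 = k := by omega
  simp [runInterpretation, symPred, h1, h2]

theorem runInterpretation_headPred :
    (runInterpretation c n eΛ eΓ).pred (headPred k) =
      cells fun t _ => eΓ (c t).Tape.head = k := by
  have h1 : (3 * k + 2) % 3 = 2 := by omega
  have h2 : (3 * k + 2) / 3 = k := by omega
  simp [runInterpretation, headPred, h1, h2]

end

variable [Inhabited Λ] {M : TM0.Machine Γ Λ} {eΛ : Λ → ℕ} {eΓ : Γ → ℕ} {G : List Γ} {S : List Λ}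
  {c : ℕ → TM0.Cfg Γ Λ} {w : List Γ}

theorem runInterpretation_models_inputWord (h0 : c 0 = TM0.init w) :
    (runInterpretation c w.length eΛ eΓ).Models (inputWord (w.map fun a => symPred (eΓ a))) := by
  rw [models_inputWord]
  have hcell (i : ℕ) : (runInterpretation c w.length eΛ eΓ).var 0 + i = cell 0 i := by
    simp [runInterpretation, cell_zero_left]
  constructor
  · rw [hcell, List.length_map]
    exact cell_mem_cells.2 ⟨rfl, le_rfl⟩
  · intro i hi
    rw [List.length_map] at hi
    rw [hcell, List.getElem_map, runInterpretation_symPred, cell_mem_cells, h0]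
    change eΓ ((Tape.mk₁ w).nth i) = _
    rw [nth_mk₁_natCast, List.getI_eq_getElem _ hi]

/-- Successor cells are exactly consecutive times at one position, so each rule reduces to the step
the run makes there. -/
theorem runInterpretation_models_dynamics (hG : ∀ a, a ∈ G)
    (hS : TM0.Supports M {q | q ∈ S}) (hΛ : Set.InjOn eΛ {q | q ∈ S})
    (hΓ : Function.Injective eΓ) (h0 : c 0 = TM0.init w)
    (hc : ∀ t, TM0.step M (c t) = some (c (t + 1))) :
    (runInterpretation c w.length eΛ eΓ).Models (dynamics M eΛ eΓ G S) := by
  have hmem (t : ℕ) : (c t).q ∈ S := by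
    induction t with
    | zero => rw [h0]; exact hS.1
    | succ t ih => exact TM0.step_supports M hS (hc t) ih
  simp only [models_dynamics _ _ _ _ hG, models_timeline, models_blanks, models_periodic,
    models_rule _ _ _ _ hG, runInterpretation_statePred, runInterpretation_symPred,
    runInterpretation_headPred]
  have hz : (runInterpretation c w.length eΛ eΓ).var 0 = cell 0 0 := by
    simp [runInterpretation, cell_zero_left]
  have hz' : InHead ((runInterpretation c w.length eΛ eΓ).var 0) = InHead 0 := rfl
  have hD : (runInterpretation c w.length eΛ eΓ).pred 0 = cells fun _ _ => True := rfl
  have hL : (runInterpretation c w.length eΛ eΓ).pred 1 = cells fun t i => t = 0 ∧ i < 0 := rfl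
  have hR : (runInterpretation c w.length eΛ eΓ).pred 2 =
    cells fun t i => t = 0 ∧ w.length ≤ i := rfl
  rw [hz', hz, hD, hL, hR]
  refine ⟨⟨⟨cell_mem_cells.2 trivial, cells_add_one fun _ _ => Iff.rfl, ?_⟩,
    cell_mem_cells.2 (by rw [h0]; rfl), ⟨?_, ?_⟩, ?_, ?_, ?_⟩,
    ⟨fun q _ => cells_add_one fun _ _ => Iff.rfl,
      fun a => ⟨cells_add_one fun _ _ => Iff.rfl, ?_⟩⟩, ?_⟩
  · rintro _ ⟨t, i, -, rfl⟩ h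
    rw [inHead_zero_cell] at h
    exact ⟨_, inHead_zero_cell.2 h, next_cell.2 rfl⟩
  · rw [cell_sub_one, cell_mem_cells]
    simp
  · rintro _ ⟨t, i, ⟨rfl, hi⟩, rfl⟩
    rw [cell_sub_one, cell_mem_cells]
    exact ⟨rfl, by omega⟩
  · rintro _ ⟨t, i, ⟨rfl, hi⟩, rfl⟩
    rw [cell_add_one, cell_mem_cells]
    exact ⟨rfl, by omega⟩
  · rintro _ ⟨t, i, ⟨rfl, hi⟩, rfl⟩
    rw [cell_mem_cells, h0]
    exact congrArg eΓ (nth_mk₁_of_neg w hi)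
  · rintro _ ⟨t, i, ⟨rfl, hi⟩, rfl⟩
    rw [cell_mem_cells, h0]
    lift i to ℕ using by omega
    exact congrArg eΓ ((nth_mk₁_natCast w i).trans (List.getI_eq_default _ (by omega)))
  · rintro _ h ⟨t, i, ha, rfl⟩
    rw [inHead_zero_cell] at h
    subst h
    simpa using ha
  · rintro q hq a _ y hxy ⟨t, i, hqt, rfl⟩ ha
    rw [next_cell] at hxy
    subst hxy
    rw [cell_mem_cells] at ha
    -- Injectivity of the numberings identifies `q` and `a` with the actual state and scanned symbol
    -- at time `t`. As the run continues, `M` prescribes an action, so the contradictory case does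
    -- not arise.
    obtain rfl := hΛ (hmem t) hq hqt
    obtain rfl := hΓ ha
    obtain ⟨⟨q', act⟩, hM, hcfg⟩ := Option.map_eq_some_iff.1 (hc t)
    dsimp only at hcfg
    rw [hM]
    rcases act with (_ | _) | a <;>
      simp only [Effect, runInterpretation_statePred, runInterpretation_symPred, cell_add_one,
        cell_sub_one, cell_mem_cells, hz', inHead_zero_cell, ← hcfg, Tape.move_left_nth,
        Tape.move_right_nth, Tape.write_nth, imp_self, implies_true, true_and]
    constructor <;> intro hi <;> simp [hi]

/-! ### Computability of the reduction -/

theorem encode_formula (φ : Formula) : Encodable.encode φ = φ.toNat := rfl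

theorem intEquivNat_natCast (n : ℕ) : Equiv.intEquivNat (n : ℤ) = 2 * n := rfl

theorem primrec_and : Primrec₂ Formula.and := by
  refine Primrec.encode_iff.1 ?_
  simp only [encode_formula, Formula.toNat]
  exact Primrec.nat_add.comp (Primrec.nat_mul.comp (Primrec.const 18)
    (Primrec₂.natPair.comp (Primrec.encode.comp Primrec.fst) (Primrec.encode.comp Primrec.snd)))
    (Primrec.const 12)

theorem primrec_atPos : Primrec₂ atPos := by
  refine Primrec.encode_iff.1 ?_
  simp only [encode_formula, atPos, Formula.toNat, intEquivNat_natCast]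
  have pair {f g : ℕ × ℕ → ℕ} (hf : Primrec f) (hg : Primrec g) :
      Primrec fun x => Nat.pair (f x) (g x) := Primrec₂.natPair.comp hf hg
  have tag {f : ℕ × ℕ → ℕ} (k : ℕ) (hf : Primrec f) : Primrec fun x => 18 * f x + k :=
    Primrec.nat_add.comp (Primrec.nat_mul.comp (Primrec.const 18) hf) (Primrec.const k)
  exact tag _ (pair (.const _) (tag _ (pair
    (tag _ (pair (.const _) (pair (.const _) (Primrec.nat_mul.comp (.const 2) .fst))))
    (tag _ (pair .snd (.const _))))))

theorem primrec_inputWord : Primrec inputWord := by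
  have hconj : Primrec Formula.conj :=
    Primrec.list_foldr Primrec.id (Primrec.const _)
      (primrec_and.comp (Primrec.fst.comp Primrec.snd) (Primrec.snd.comp Primrec.snd)).to₂
  refine primrec_and.comp (primrec_atPos.comp Primrec.list_length (Primrec.const 2))
    (hconj.comp (Primrec.list_map (Primrec.list_range.comp Primrec.list_length) ?_))
  exact primrec_atPos.comp Primrec.snd
    ((Primrec.list_getD 0).comp Primrec.fst Primrec.snd)

/-- Digits come least significant first, and zero is the empty word. The recursion through `n / 2`
is what makes the encoding primitive recursive. -/
theorem trNat_eq_cons (n : ℕ) (hn : n ≠ 0) :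
    PartrecToTM2.trNat n =
      (if n % 2 = 0 then PartrecToTM2.Γ'.bit0 else PartrecToTM2.Γ'.bit1) ::
        PartrecToTM2.trNat (n / 2) := by
  have trNum_bit (p : Num) (hp : p ≠ 0) :
      PartrecToTM2.trNum p.bit0 = PartrecToTM2.Γ'.bit0 :: PartrecToTM2.trNum p := by
    cases p with
    | zero => exact absurd rfl hp
    | pos p => rfl
  have trNum_bit1 (p : Num) :
      PartrecToTM2.trNum p.bit1 = PartrecToTM2.Γ'.bit1 :: PartrecToTM2.trNum p := by
    cases p <;> rfl
  rcases Nat.even_or_odd' n with ⟨m, rfl | rfl⟩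
  · have h : ((2 * m : ℕ) : Num) = (m : Num).bit0 := by
      rw [← Num.bit0_of_bit0, two_mul, Nat.cast_add]
    rw [PartrecToTM2.trNat, h, trNum_bit]
    · simp [PartrecToTM2.trNat]
    · intro h
      have := congrArg (fun p : Num => (p : ℕ)) h
      simp at this
      omega
  · have h : ((2 * m + 1 : ℕ) : Num) = (m : Num).bit1 := by
      rw [← Num.bit1_of_bit1, two_mul, Nat.cast_succ, Nat.cast_add]
    have h1 : (2 * m + 1) % 2 = 1 := by omega
    have h2 : (2 * m + 1) / 2 = m := by omega
    rw [PartrecToTM2.trNat, h, trNum_bit1, h1, h2]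
    rfl

theorem primrec_map_trNat (e : PartrecToTM2.Γ' → ℕ) :
    Primrec fun n => (PartrecToTM2.trNat n).map e := by
  have key : Primrec₂ fun (_ : Unit) (n : ℕ) => (PartrecToTM2.trNat n).map e := by
    -- Here `l` lists the values at all arguments below `n`: its length is `n`, and the entry at `n
    -- / 2` is the recursive call.
    refine Primrec.nat_strong_rec _ (g := fun _ l => some (if l.length = 0 then [] else
      (if l.length % 2 = 0 then e .bit0 else e .bit1) :: l.getD (l.length / 2) [])) ?_ ?_
    · have hlen : Primrec fun x : Unit × List (List ℕ) => x.2.length :=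
        Primrec.list_length.comp Primrec.snd
      refine Primrec.option_some.comp (Primrec.ite (Primrec.eq.comp hlen (.const 0)) (.const [])
        (Primrec.list_cons.comp (Primrec.ite (Primrec.eq.comp
          (Primrec.nat_mod.comp hlen (.const 2)) (.const 0)) (.const _) (.const _))
          ((Primrec.list_getD []).comp Primrec.snd (Primrec.nat_div.comp hlen (.const 2)))))
    · intro _ n
      rcases eq_or_ne n 0 with rfl | hn
      · simp
      · have : n / 2 < n := by omega
        rw [trNat_eq_cons n hn]
        simp [hn, this]
        split_ifs <;> rfl
  exact key.comp (.const ()) .id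

end RDLUUP

/-! ### The reduction from the halting problem -/

theorem mainTheorem3 : ¬ ComputablePred RDLUUP.Formula.Satisfiable := by
  intro hsat
  obtain ⟨Γ, Λ, _, _, _, M, S, b, w, hS, hM⟩ := RDLUUP.exists_universal_machine
  -- Runs never leave the finite set `S`, so only its states need distinct numbers.
  obtain ⟨eΛ, hΛ⟩ := Set.countable_iff_exists_injOn.1 S.countable_toSet
  obtain ⟨eΓ, hΓ⟩ := exists_injective_nat Γ
  have := Fintype.ofFinite Γ
  have hG (a : Γ) : a ∈ (Finset.univ : Finset Γ).toList := by simp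
  have hS' : (S : Set Λ) = {q | q ∈ S.toList} := by ext; simp
  rw [hS'] at hS hΛ
  set input : ℕ → List Γ := fun n => b :: (Turing.PartrecToTM2.trNat n).reverse.map w with hinput
  set word : ℕ → List ℕ := fun n => (input n).map fun a => RDLUUP.symPred (eΓ a) with hword
  -- This conjunct is a constant, so noncomputable choices in the numberings do no harm to the
  -- computability of the reduction.
  set F := RDLUUP.dynamics M eΛ eΓ (Finset.univ : Finset Γ).toList S.toList
  have hwordPrim : Primrec word := by
    refine (Primrec.list_cons.comp (.const (RDLUUP.symPred (eΓ b))) (Primrec.list_reverse.comp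
      (RDLUUP.primrec_map_trNat fun a => RDLUUP.symPred (eΓ (w a))))).of_eq fun n => ?_
    simp [hword, hinput, Function.comp_def]
  have hred (n : ℕ) : (F.and (RDLUUP.inputWord (word n))).Satisfiable ↔
      ¬ ((Denumerable.ofNat Nat.Partrec.Code n).eval 0).Dom := by
    rw [← hM]
    constructor
    · rintro ⟨I, hI, hw⟩
      exact RDLUUP.not_dom_of_models hG hS hI hw
    · intro h
      obtain ⟨c, h0, hc⟩ :=
        RDLUUP.exists_run_of_not_eval_dom (Turing.TM0.step M) (Turing.TM0.init (input n)) h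
      exact ⟨_, RDLUUP.runInterpretation_models_dynamics hG hS hΛ hΓ h0 hc,
        RDLUUP.runInterpretation_models_inputWord h0⟩
  have hcomp : Computable fun c : Nat.Partrec.Code =>
      F.and (RDLUUP.inputWord (word (Encodable.encode c))) :=
    (RDLUUP.primrec_and.comp (.const F) (RDLUUP.primrec_inputWord.comp
      (hwordPrim.comp Primrec.encode))).to_comp
  have hhalt : ComputablePred fun c : Nat.Partrec.Code => ¬ (c.eval 0).Dom :=
    ComputablePred.computable_of_manyOneReducible
      ⟨_, hcomp, fun c => by rw [hred, Denumerable.ofNat_encode]⟩ hsat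
  exact ComputablePred.halting_problem 0 (by simpa using hhalt.not)
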